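/- Let $\pi$ be a (discrete) group. A matrix $A\in M(d\times d,\mathbb{Z}\pi)$ acts on the Hilbert space $\ell^2(\pi)^d$ by multiplication from the left; $A^*$ denotes the Hilbert space adjoint of this operator. For a bounded operator $T=(T_{ij})$ on $\ell^2(\pi)^d$ put $\operatorname{tr}_\pi(T)=\sum_{i=1}^d\langle T_{ii}1,1\rangle_{\ell^2(\pi)}$, where $1\in\pi\subset\ell^2(\pi)$ is the unit element. For a positive self-adjoint matrix operator $\Delta$ on $\ell^2(\pi)^d$ let $F_\Delta(\lambda)=\operatorname{tr}_\pi\chi_{[0,\lambda]}(\Delta)$ be its spectral density function, and define the logarithm of its regularized (Fuglede--Kadison) determinant by $$\ln\operatorname{Det}_\pi(\Delta)=\int_{0^+}^\infty\ln(\lambda)\,dF_\Delta(\lambda)$$ if the integral converges, and $\ln\operatorname{Det}_\pi(\Delta)=-\infty$ otherwise. Let $Wh(\pi)=K_1(\mathbb{Z}\pi)/\{\pm g: g\in\pi\}$ be the Whitehead group, where $K_1(\mathbb{Z}\pi)$ is the abelianization of $GL(\mathbb{Z}\pi)=\varinjlim_d GL_d(\mathbb{Z}\pi)$. **Theorem.**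 (0) For $A\in GL_d(\mathbb{Z}\pi)$ the number $\ln\operatorname{Det}_\pi(A^*A)$ depends only on the class of $A$ in $Wh(\pi)$. Hence $A\mapsto\ln\operatorname{Det}_\pi(A^*A)$ is a well-defined map on $Wh(\pi)$. (1) If $\ln\operatorname{Det}_\pi(A^*A)\ge 0$ for every $A\in Wh(\pi)$, then $\ln\operatorname{Det}_\pi(A^*A)=0$ for every $A\in Wh(\pi)$, i.e. the Fuglede--Kadison determinant is trivial on $Wh(\pi)$. (2) In particular, if $\pi$ has semi-integral determinant, i.e. $\ln\operatorname{Det}_\pi(\Delta)\ge 0$ for all $d$ and all positive self-adjoint $\Delta\in M(d\times d,\mathbb{Z}\pi)$, then $\pi$ has Whitehead-trivial determinant, i.e. $\ln\operatorname{Det}_\pi(A^*A)=0$ for every $A\in Wh(\pi)$. -/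

import Mathlib

open scoped InnerProductSpace

noncomputable section

namespace GroupDet

/-! ### The Hilbert space `ℓ²(π)^d` and the action of integral matrices -/

/-- The Hilbert space `ℓ²(π)` of square summable complex functions on the discrete group `π`. -/
abbrev L2 (π : Type*) : Type _ := lp (fun _ : π => ℂ) 2

/-- The Hilbert space `ℓ²(π)^d`. -/
abbrev L2Pow (π : Type*) (d : ℕ) : Type _ := PiLp 2 (fun _ : Fin d => L2 π)

section Action

variable {π : Type*} [Group π]

theorem memlp_translate (g : π) (f : L2 π) :
    Memℓp (fun h : π => (f : π → ℂ) (g⁻¹ * h)) 2 := by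
  have hf := lp.memℓp f
  rw [memℓp_gen_iff (by norm_num)] at hf ⊢
  exact hf.comp_injective (mul_right_injective g⁻¹)

/-- Left translation by `g` on `ℓ²(π)`: `(g • f)(h) = f (g⁻¹ h)`, so that the basis vector `δ_h`
is sent to `δ_{gh}`. -/
def translate (g : π) : L2 π →L[ℂ] L2 π :=
  LinearMap.mkContinuous
    { toFun := fun f => ⟨fun h : π => (f : π → ℂ) (g⁻¹ * h), memlp_translate g f⟩
      map_add' := fun _ _ => rfl
      map_smul' := fun _ _ => rfl } 1 (by
    intro f
    rw [one_mul]
    refine lp.norm_le_of_forall_sum_le (by norm_num) (norm_nonneg _) fun s => ?_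
    have h1 := lp.sum_rpow_le_norm_rpow (p := 2) (by norm_num) f
      (s.map ⟨fun h => g⁻¹ * h, mul_right_injective g⁻¹⟩)
    rw [Finset.sum_map] at h1
    exact h1)

@[simp] theorem translate_apply (g : π) (f : L2 π) (h : π) :
    (translate g f : π → ℂ) h = (f : π → ℂ) (g⁻¹ * h) := rfl

/-- The left regular representation of `π` on `ℓ²(π)`. -/
def leftRegular : π →* (L2 π →L[ℂ] L2 π) where
  toFun := translate
  map_one' := by
    ext f h
    simp
  map_mul' a b := by
    ext f h
    simp [mul_assoc]

/-- The action of the integral group ring `ℤπ` on `ℓ²(π)` by multiplication from the left: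
`∑ n_g g` acts as `∑ n_g • translate g`. -/
def ringAct : MonoidAlgebra ℤ π →ₐ[ℤ] (L2 π →L[ℂ] L2 π) :=
  MonoidAlgebra.lift ℤ (L2 π →L[ℂ] L2 π) π leftRegular

/-- The bounded operator on `ℓ²(π)^d` given by a matrix over `ℤπ`, acting from the left:
`(A x)_i = ∑ j, A_{ij} x_j`. -/
def matOp {d : ℕ} (A : Matrix (Fin d) (Fin d) (MonoidAlgebra ℤ π)) :
    L2Pow π d →L[ℂ] L2Pow π d :=
  (PiLp.continuousLinearEquiv 2 ℂ (fun _ : Fin d => L2 π)).symm.toContinuousLinearMap ∘L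
    ContinuousLinearMap.pi (fun i => ∑ j, ringAct (A i j) ∘L PiLp.proj 2 (fun _ : Fin d => L2 π) j)

@[simp] theorem matOp_apply {d : ℕ} (A : Matrix (Fin d) (Fin d) (MonoidAlgebra ℤ π))
    (x : L2Pow π d) (i : Fin d) : matOp A x i = ∑ j, ringAct (A i j) (x j) := by
  simp [matOp]

/-- The vector of `ℓ²(π)^d` which is the unit element `1 ∈ π ⊆ ℓ²(π)` in the `i`-th coordinate and
`0` in the others. -/
def unitVec (π : Type*) [Group π] {d : ℕ} (i : Fin d) : L2Pow π d := by
  classical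
  exact PiLp.single 2 i (lp.single 2 (1 : π) (1 : ℂ))

/-- The trace `tr_π(T) = ∑ i, tr_π(T_{ii})`, where `tr_π(a) = ⟨a 1, 1⟩` is the coefficient of the
trivial group element in `a`. -/
def trace {d : ℕ} (T : L2Pow π d →L[ℂ] L2Pow π d) : ℂ :=
  ∑ i : Fin d, ⟪unitVec π i, T (unitVec π i)⟫_ℂ

end Action

/-! ### Spectral projections, the spectral density function, the regularized determinant -/

section Spectral

variable {H : Type*} [NormedAddCommGroup H] [InnerProductSpace ℂ H] [CompleteSpace H]

/-- The positive part `(T - c)₊` of `T - c` for a self-adjoint operator `T`. -/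
def posPart (T : H →L[ℂ] H) (c : ℝ) : H →L[ℂ] H :=
  cfc (fun t : ℝ => max (t - c) 0) T

/-- The spectral projection `χ_{(-∞,c]}(T)` of a self-adjoint operator `T`, as the orthogonal
projection onto the kernel of `(T - c)₊`. For positive `T` this is `χ_{[0,c]}(T)`. -/
def specProj (T : H →L[ℂ] H) (c : ℝ) : H →L[ℂ] H :=
  (LinearMap.ker (posPart T c).toLinearMap).starProjection

theorem ker_posPart_mono (T : H →L[ℂ] H) {a b : ℝ} (hab : a ≤ b) :
    LinearMap.ker (posPart T a).toLinearMap ≤ LinearMap.ker (posPart T b).toLinearMap := by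
  rcases hab.eq_or_lt with rfl | hlt
  · exact le_rfl
  intro x hx
  have hx' : posPart T a x = 0 := hx
  change posPart T b x = 0
  have hpos : ∀ t : ℝ, 0 < max (t - a) (b - a) := fun t => lt_max_of_lt_right (sub_pos.2 hlt)
  have hfun : (fun t : ℝ => max (t - b) 0) =
      fun t : ℝ => max (t - b) 0 / max (t - a) (b - a) * max (t - a) 0 := by
    funext t
    rcases le_total t b with h | h
    · simp [max_eq_right (sub_nonpos.2 h)]
    · have h1 : max (t - a) (b - a) = t - a := max_eq_left (by linarith)
      have h2 : max (t - a) 0 = t - a := max_eq_left (by linarith)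
      have h3 : t - a ≠ 0 := (show 0 < t - a by linarith).ne'
      rw [h1, h2, div_mul_cancel₀ _ h3]
  have hc : Continuous fun t : ℝ => max (t - b) 0 / max (t - a) (b - a) :=
    Continuous.div (by fun_prop) (by fun_prop) fun t => (hpos t).ne'
  have hmul : posPart T b =
      cfc (fun t : ℝ => max (t - b) 0 / max (t - a) (b - a)) T * posPart T a := by
    unfold posPart
    conv_lhs => rw [hfun]
    exact cfc_mul _ _ T hc.continuousOn (by fun_prop)
  rw [hmul]
  change cfc (fun t : ℝ => max (t - b) 0 / max (t - a) (b - a)) T (posPart T a x) = 0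
  rw [hx', map_zero]

theorem re_inner_specProj_mono (T : H →L[ℂ] H) (x : H) {a b : ℝ} (hab : a ≤ b) :
    (⟪x, specProj T a x⟫_ℂ).re ≤ (⟪x, specProj T b x⟫_ℂ).re := by
  have hle := Submodule.starProjection_le_starProjection_iff.2 (ker_posPart_mono T hab)
  have h := ((ContinuousLinearMap.le_def _ _).1 hle).re_inner_nonneg_right x
  rw [sub_apply, inner_sub_right] at h
  simpa [specProj] using h

end Spectral

section Determinant

variable {π : Type*} [Group π] {d : ℕ}

/-- The spectral density function `F_T(c) = tr_π χ_{[0,c]}(T)` of a positive operator `T`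
on `ℓ²(π)^d`. -/
def specDensity (T : L2Pow π d →L[ℂ] L2Pow π d) (c : ℝ) : ℝ := (trace (specProj T c)).re

theorem specDensity_mono (T : L2Pow π d →L[ℂ] L2Pow π d) : Monotone (specDensity T) := by
  intro a b hab
  simp only [specDensity, trace, Complex.re_sum]
  exact Finset.sum_le_sum fun i _ => re_inner_specProj_mono T _ hab

/-- The Lebesgue-Stieltjes measure `dF_T` on `ℝ`. -/
def specMeasure (T : L2Pow π d →L[ℂ] L2Pow π d) : MeasureTheory.Measure ℝ :=
  (specDensity_mono T).stieltjesFunction.measure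

open Classical in
/-- The logarithm of the regularized (Fuglede-Kadison) determinant of a positive operator `T`
on `ℓ²(π)^d`: the integral of `log` over `(0,∞)` against `dF_T` if it converges, else `-∞`. -/
def lnDet (T : L2Pow π d →L[ℂ] L2Pow π d) : EReal :=
  if MeasureTheory.IntegrableOn Real.log (Set.Ioi 0) (specMeasure T) then
    ((∫ t in Set.Ioi (0 : ℝ), Real.log t ∂(specMeasure T) : ℝ) : EReal)
  else ⊥

/-- `ln Det_π(A* A)` for a matrix `A` over `ℤπ`, with `A*` the Hilbert space adjoint of `A`. -/
def lnDetStar (A : Matrix (Fin d) (Fin d) (MonoidAlgebra ℤ π)) : EReal :=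
  lnDet (ContinuousLinearMap.adjoint (matOp A) ∘L matOp A)

end Determinant

/-! ### The Whitehead group -/

section Whitehead

/-- Stabilization `A ↦ A ⊕ 1` from `n × n` to `m × m` matrices, for `n ≤ m`. -/
def stabMat (R : Type*) [Ring R] {n m : ℕ} (h : n ≤ m) :
    Matrix (Fin n) (Fin n) R →* Matrix (Fin m) (Fin m) R where
  toFun A := Matrix.of fun i j =>
    if hij : i.1 < n ∧ j.1 < n then A ⟨i.1, hij.1⟩ ⟨j.1, hij.2⟩ else if i = j then 1 else 0
  map_one' := by
    ext i j
    by_cases hij : i.1 < n ∧ j.1 < n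
    · simp [Matrix.one_apply, Fin.ext_iff]
    · simp [hij, Matrix.one_apply]
  map_mul' A B := by
    obtain ⟨k, rfl⟩ := Nat.exists_eq_add_of_le h
    ext i j
    rw [Matrix.mul_apply, Fin.sum_univ_add]
    by_cases hi : i.1 < n <;> by_cases hj : j.1 < n
    · have h3 : ∀ x : Fin k, i ≠ Fin.natAdd n x := fun x h => by
        rw [h] at hi
        simp at hi
      simp [Matrix.mul_apply, hi, hj, h3]
    · have h1 : i ≠ j := fun h => hj (h ▸ hi)
      have h2 : ∀ x : Fin n, Fin.castAdd k x ≠ j := fun x h => hj (h ▸ x.2)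
      have h3 : ∀ x : Fin k, i ≠ Fin.natAdd n x := fun x h => by
        rw [h] at hi
        simp at hi
      simp [hj, h1, h2, h3]
    · have h1 : i ≠ j := fun h => hi (h ▸ hj)
      have h2 : ∀ x : Fin n, i ≠ Fin.castAdd k x := fun x h => hi (h ▸ x.2)
      have h3 : ∀ x : Fin k, Fin.natAdd n x ≠ j := fun x h => by
        rw [← h] at hj
        simp at hj
      simp [hi, h1, h2, h3]
    · obtain ⟨x, rfl⟩ : ∃ x : Fin k, i = Fin.natAdd n x :=
        ⟨⟨i.1 - n, by omega⟩, by ext; simp; omega⟩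
      have h2 : ∀ y : Fin n, Fin.natAdd n x ≠ Fin.castAdd k y := fun y h => hi (h ▸ y.2)
      simp only [hi, false_and, dite_false, Matrix.of_apply, h2, if_false, zero_mul,
        Finset.sum_const_zero, zero_add, ite_mul, one_mul, (Fin.natAdd_injective k n).eq_iff,
        Finset.sum_ite_eq, Finset.mem_univ, if_true]

/-- The stabilization homomorphism `GL_n(R) → GL_m(R)`, `A ↦ A ⊕ 1`, for `n ≤ m`. -/
def stab (R : Type*) [Ring R] (n m : ℕ) (h : n ≤ m) : GL (Fin n) R →* GL (Fin m) R :=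
  Units.map (stabMat R h)

instance stab_directedSystem (R : Type*) [Ring R] :
    DirectedSystem (fun n : ℕ => GL (Fin n) R) (fun n m h => stab R n m h) where
  map_self n A := by
    ext i j
    simp [stab, stabMat]
  map_map k m n hnm hmk A := by
    ext i j
    by_cases hk : i.1 < m ∧ j.1 < m
    · simp [stab, stabMat, hk, Fin.ext_iff]
    · have hn : ¬ (i.1 < n ∧ j.1 < n) := fun h => hk ⟨h.1.trans_le hnm, h.2.trans_le hnm⟩
      simp [stab, stabMat, hk, hn]

/-- The stable general linear group `GL(R)`, the direct limit of the groups `GL_n(R)`. -/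
abbrev StableGL (R : Type*) [Ring R] : Type _ :=
  DirectLimit (fun n : ℕ => GL (Fin n) R) (stab R)

/-- `K₁(R)`, the abelianization of `GL(R)`. -/
abbrev K1 (R : Type*) [Ring R] : Type _ := Abelianization (StableGL R)

/-- The class in `K₁(R)` of an invertible matrix over `R`. -/
def K1.mk {R : Type*} [Ring R] {d : ℕ} (A : GL (Fin d) R) : K1 R :=
  Abelianization.of (⟦⟨d, A⟩⟧ : StableGL R)

variable (π : Type*) [Group π]

/-- The invertible `1 × 1` matrix `(g)` over `ℤπ`, for `g ∈ π`. -/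
def groupUnit (g : π) : GL (Fin 1) (MonoidAlgebra ℤ π) :=
  Units.map (Matrix.scalar (Fin 1)).toMonoidHom
    (Units.map (MonoidAlgebra.of ℤ π) (toUnits g))

/-- The subgroup of `K₁(ℤπ)` of the classes of the trivial units `±g`, `g ∈ π`. -/
def trivialUnits : Subgroup (K1 (MonoidAlgebra ℤ π)) :=
  Subgroup.closure {x | ∃ g : π, x = K1.mk (groupUnit π g) ∨ x = K1.mk (-groupUnit π g)}

/-- The Whitehead group `Wh(π) = K₁(ℤπ) / {±g}`. -/
abbrev Wh : Type _ := K1 (MonoidAlgebra ℤ π) ⧸ trivialUnits π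

variable {π}

/-- The class in `Wh(π)` of an invertible matrix over `ℤπ`. -/
def Wh.mk {d : ℕ} (A : GL (Fin d) (MonoidAlgebra ℤ π)) : Wh π :=
  QuotientGroup.mk (K1.mk A)

theorem Wh.mk_surjective (w : Wh π) :
    ∃ (d : ℕ) (A : GL (Fin d) (MonoidAlgebra ℤ π)), Wh.mk A = w := by
  obtain ⟨x, rfl⟩ := QuotientGroup.mk_surjective w
  obtain ⟨y, rfl⟩ := QuotientGroup.mk_surjective x
  obtain ⟨d, A, rfl⟩ := DirectLimit.exists_eq_mk (stab (MonoidAlgebra ℤ π)) y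
  exact ⟨d, A, rfl⟩

/-- The map `A ↦ ln Det_π(A* A)` on `Wh(π)`, computed on some matrix representing the class. -/
def lnDetWh (w : Wh π) : EReal :=
  lnDetStar (Wh.mk_surjective w).choose_spec.choose.val

variable (π)

/-- `π` has semi-integral determinant: `ln Det_π(Δ) ≥ 0` for every positive self-adjoint square
matrix `Δ` over `ℤπ`. -/
def SemiIntegralDet : Prop :=
  ∀ (d : ℕ) (D : Matrix (Fin d) (Fin d) (MonoidAlgebra ℤ π)),
    (matOp D).IsPositive → 0 ≤ lnDet (matOp D)

/-- `π` has Whitehead-trivial determinant: `ln Det_π(A* A) = 0` for all `A ∈ Wh(π)`. -/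
def WhiteheadTrivialDet : Prop := ∀ w : Wh π, lnDetWh w = 0

end Whitehead

end GroupDet

end

/-! The whole theorem follows once `A ↦ ln Det(A* A)` is a real-valued homomorphism on `Wh(π)`. A
homomorphism into `ℝ` whose values are all nonnegative vanishes, since `w` and `w⁻¹` have opposite
values; and semi-integrality gives nonnegativity because `A* A` is itself a positive matrix over
`ℤπ`.

For invertible `S` the spectrum of `S* S` is a compact subset of `(0,∞)`, so the integral of the
logarithm is finite and, for `c ≥ ‖S* S‖`, equals `log c · tr 1 - ∑ tr((1 - S* S / c)^(n+1)) /
(n+1)` (`exists_lnDet_eq_hasSum`). This reduces everything to the trace `tr_π` of powers.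

Multiplicativity (`realLnDet_mul`) is proved along the segment `X_z = 1 - z(1 - S* S)`: the log
series of `X_z` and of `T* X_z T` have the same derivative in `z`, because `tr_π` is a trace on
operators commuting with right translations (`trace_mul_comm`). Stabilization only adds `k` scalar
blocks, whose contribution to the series cancels the change in `tr 1` (`realLnDet_stab`). Trivial
units are unitary, so they lie in the kernel, and the homomorphism descends from `GL_d` to `Wh(π)`.
-/

open scoped InnerProductSpace

noncomputable section

namespace GroupDet

open MeasureTheory Filter Topology

/-! ### Spectral measures, spectral projections and the logarithm series -/

section SpectralMeasure

variable {H : Type*} [NormedAddCommGroup H] [InnerProductSpace ℂ H] [CompleteSpace H]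

/-- The spectral measure of a self-adjoint operator at a vector, from the
Riesz-Markov-Kakutani theorem applied to the continuous functional calculus. -/
theorem exists_vectorSpectralMeasure (T : H →L[ℂ] H) (hT : IsSelfAdjoint T) (v : H) :
    ∃ ν : Measure ℝ, IsFiniteMeasure ν ∧ ν (spectrum ℝ T)ᶜ = 0 ∧
      ∀ f : ℝ → ℝ, ContinuousOn f (spectrum ℝ T) →
        ∫ t, f t ∂ν = (⟪v, cfc f T v⟫_ℂ).re := by
  -- The spectrum is compact, so compactly supported continuous functions on it are all continuous
  -- functions.
  let L₀ : CompactlySupportedContinuousMap (spectrum ℝ T) ℝ →ₗ[ℝ] ℝ :=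
    { toFun := fun f => (⟪v, cfcHom hT (f : C(spectrum ℝ T, ℝ)) v⟫_ℂ).re
      map_add' := fun f g => by
        have : ((f + g : CompactlySupportedContinuousMap (spectrum ℝ T) ℝ) :
          C(spectrum ℝ T, ℝ)) = (f : C(spectrum ℝ T, ℝ)) + (g : C(spectrum ℝ T, ℝ)) := rfl
        rw [this, map_add, add_apply, inner_add_right, Complex.add_re]
      map_smul' := fun c f => by
        have : ((c • f : CompactlySupportedContinuousMap (spectrum ℝ T) ℝ) :
          C(spectrum ℝ T, ℝ)) = c • (f : C(spectrum ℝ T, ℝ)) := rfl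
        rw [this, map_smul, smul_apply, inner_smul_right_eq_smul]
        simp }
  let L : CompactlySupportedContinuousMap (spectrum ℝ T) ℝ →ₚ[ℝ] ℝ :=
    PositiveLinearMap.mk₀ L₀ fun f hf => by
      have h : 0 ≤ cfcHom hT (f : C(spectrum ℝ T, ℝ)) := by
        rw [cfcHom_nonneg_iff]
        exact fun x => hf x
      exact ((ContinuousLinearMap.nonneg_iff_isPositive _).1 h).re_inner_nonneg_right v
  let ν₀ := RealRMK.rieszMeasure L
  have hemb : MeasurableEmbedding (Subtype.val : spectrum ℝ T → ℝ) :=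
    MeasurableEmbedding.subtype_coe (spectrum.isClosed T).measurableSet
  refine ⟨ν₀.map Subtype.val, inferInstance, ?_, fun f hf => ?_⟩
  · rw [hemb.map_apply]
    convert measure_empty (μ := ν₀)
    ext x
    simp
  · rw [hemb.integral_map]
    have := RealRMK.integral_rieszMeasure L
      (CompactlySupportedContinuousMap.continuousMapEquiv ⟨_, hf.domRestrict⟩)
    rw [cfc_apply f T hT hf]
    exact this

/-- The spectral measure of a half line is given by the spectral projection. -/
theorem measureReal_Iic_eq_specProj (T : H →L[ℂ] H) (hT : IsSelfAdjoint T) (v : H)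
    (ν : Measure ℝ) [IsFiniteMeasure ν]
    (hν : ∀ f : ℝ → ℝ, ContinuousOn f (spectrum ℝ T) → ∫ t, f t ∂ν = (⟪v, cfc f T v⟫_ℂ).re)
    (c : ℝ) : ν.real (Set.Iic c) = (⟪v, specProj T c v⟫_ℂ).re := by
  let s : ℝ → ℝ := fun t => max (t - c) 0
  have hs0 : ∀ t, 0 ≤ s t := fun t => le_max_right _ _
  have hsc : Continuous s := by fun_prop
  -- Continuous functions decreasing pointwise to the indicator of `(-∞, c]`. The vectors `f_n(T) v`
  -- will converge to the projection of `v`.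
  let f : ℕ → ℝ → ℝ := fun n t => 1 / (1 + n * s t)
  have hden : ∀ (n : ℕ) (t : ℝ), 0 < 1 + (n : ℝ) * s t := fun n t => by have := hs0 t; positivity
  have hf0 : ∀ n t, 0 ≤ f n t := fun n t => (one_div_pos.2 (hden n t)).le
  have hf1 : ∀ n t, f n t ≤ 1 := fun n t => by
    rw [div_le_one (hden n t)]
    have := mul_nonneg n.cast_nonneg (hs0 t) (α := ℝ)
    linarith
  have hanti : ∀ t, Antitone fun n => f n t := fun t n m hnm => by
    have : (n : ℝ) ≤ m := by exact_mod_cast hnm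
    have := mul_le_mul_of_nonneg_right this (hs0 t)
    exact one_div_le_one_div_of_le (hden n t) (by linarith)
  have hfc : ∀ n, Continuous (f n) := fun n =>
    Continuous.div (by fun_prop) (by fun_prop) fun t => (hden n t).ne'
  have hlim : ∀ t, Tendsto (fun n => f n t) atTop (𝓝 ((Set.Iic c).indicator 1 t)) := by
    intro t
    by_cases ht : t ≤ c
    · have : s t = 0 := max_eq_right (by linarith)
      simp [f, this, ht]
    · have h1 : 0 < s t := lt_max_of_lt_left (by linarith)
      rw [Set.indicator_of_notMem (by simpa using ht)]
      refine Tendsto.div_atTop tendsto_const_nhds ?_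
      exact tendsto_atTop_add_const_left _ _
        (tendsto_natCast_atTop_atTop.atTop_mul_const h1)
  have hint : Tendsto (fun n => ∫ t, f n t ∂ν) atTop (𝓝 (ν.real (Set.Iic c))) := by
    rw [← integral_indicator_one measurableSet_Iic]
    refine tendsto_integral_of_dominated_convergence 1 (fun n => (hfc n).aestronglyMeasurable)
      (integrable_const _) (fun n => ae_of_all _ fun t => ?_) (ae_of_all _ hlim)
    rw [Real.norm_of_nonneg (hf0 n t)]
    exact hf1 n t
  let w : ℕ → H := fun n => cfc (f n) T v
  have hself : ∀ g : ℝ → ℝ, IsSelfAdjoint (cfc g T) := fun g => cfc_predicate g T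
  -- Since `0 ≤ f_n - f_m ≤ 1`, the square is at most `f_n - f_m`; convergence of the integrals then
  -- makes `w` Cauchy.
  have hdist : ∀ n m, n ≤ m → dist (w n) (w m) ^ 2 ≤ ∫ t, f n t ∂ν - ∫ t, f m t ∂ν := by
    intro n m hnm
    have h1 : w n - w m = cfc (fun t => f n t - f m t) T v := by
      rw [cfc_sub _ _ T (hfc n).continuousOn (hfc m).continuousOn]
      rfl
    have hcd : Continuous fun t => f n t - f m t := (hfc n).sub (hfc m)
    have h2 : dist (w n) (w m) ^ 2 = ∫ t, (f n t - f m t) * (f n t - f m t) ∂ν := by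
      have hcm : Continuous fun t => (f n t - f m t) * (f n t - f m t) := hcd.mul hcd
      rw [hν _ hcm.continuousOn, cfc_mul _ _ T hcd.continuousOn hcd.continuousOn,
        dist_eq_norm, h1, ← inner_self_eq_norm_sq (𝕜 := ℂ)]
      have := (ContinuousLinearMap.adjoint_inner_right (cfc (fun t => f n t - f m t) T) v
        (cfc (fun t => f n t - f m t) T v))
      rw [(hself _).adjoint_eq] at this
      rw [mul_apply_eq_comp, this]
      rfl
    have hint' : ∀ k, Integrable (f k) ν := fun k =>
      Integrable.of_bound (hfc k).aestronglyMeasurable 1 (ae_of_all _ fun t => by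
        rw [Real.norm_of_nonneg (hf0 k t)]
        exact hf1 k t)
    rw [h2, ← integral_sub (hint' n) (hint' m)]
    refine integral_mono_of_nonneg (ae_of_all _ fun t => mul_self_nonneg _)
      ((hint' n).sub (hint' m)) (ae_of_all _ fun t => ?_)
    have h3 : 0 ≤ f n t - f m t := sub_nonneg.2 (hanti t hnm)
    have h4 : f n t - f m t ≤ 1 := by linarith [hf0 m t, hf1 n t]
    exact mul_le_of_le_one_left h3 h4
  have hcauchy : CauchySeq w := by
    refine Metric.cauchySeq_iff'.2 fun ε hε => ?_
    obtain ⟨N, hN⟩ := Metric.cauchySeq_iff'.1 hint.cauchySeq (ε ^ 2) (by positivity)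
    refine ⟨N, fun n hn => ?_⟩
    have h1 := hdist N n hn
    have h2 := hN n hn
    rw [Real.dist_eq, abs_lt] at h2
    rw [dist_comm]
    exact lt_of_pow_lt_pow_left₀ 2 hε.le (by linarith)
  obtain ⟨w₀, hw₀⟩ := cauchySeq_tendsto_of_complete hcauchy
  have hker : w₀ ∈ LinearMap.ker (posPart T c).toLinearMap := by
    have h1 : Tendsto (fun n => posPart T c (w n)) atTop (𝓝 (posPart T c w₀)) :=
      ((posPart T c).continuous.tendsto _).comp hw₀
    -- The bound `s · f_n = s / (1 + n s) ≤ 1/n` is uniform in `t`.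
    have h2 : Tendsto (fun n => posPart T c (w n)) atTop (𝓝 0) := by
      have hz : Tendsto (fun n : ℕ => 1 / (n : ℝ) * ‖v‖) atTop (𝓝 0) := by
        simpa using (tendsto_one_div_atTop_nhds_zero_nat (𝕜 := ℝ)).mul_const ‖v‖
      refine squeeze_zero_norm' ?_ hz
      filter_upwards [eventually_gt_atTop 0] with n hn
      have h3 : posPart T c (w n) = cfc (fun t => s t * f n t) T v := by
        rw [cfc_mul _ _ T hsc.continuousOn (hfc n).continuousOn]
        rfl
      rw [h3]
      refine ((cfc (fun t => s t * f n t) T).le_opNorm v).trans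
        (mul_le_mul_of_nonneg_right ?_ (norm_nonneg _))
      refine norm_cfc_le (by positivity) fun t _ => ?_
      rw [Real.norm_of_nonneg (mul_nonneg (hs0 t) (hf0 n t)), mul_one_div,
        div_le_div_iff₀ (hden n t) (by positivity)]
      linarith
    exact tendsto_nhds_unique h1 h2
  have hproj : specProj T c v = w₀ := by
    refine (Submodule.eq_starProjection_of_mem_of_inner_eq_zero hker fun k hk => ?_)
    -- `1 - f_n` is a multiple of `s`, so `f_n(T)` fixes the kernel of `s(T)`; self-adjointness then
    -- gives `v - w n ⟂ k`.
    have hfk : ∀ n, cfc (f n) T k = k := by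
      intro n
      have hq : Continuous fun t => (n : ℝ) / (1 + n * s t) :=
        Continuous.div (by fun_prop) (by fun_prop) fun t => (hden n t).ne'
      have h1 : cfc (fun t => 1 - (n : ℝ) / (1 + n * s t) * s t) T = cfc (f n) T := by
        congr 1
        funext t
        have := (hden n t).ne'
        simp only [f]
        field_simp
        ring
      have hqs : Continuous fun t => (n : ℝ) / (1 + n * s t) * s t := hq.mul hsc
      rw [← h1, cfc_sub _ _ T continuousOn_const hqs.continuousOn,
        cfc_mul _ _ T hq.continuousOn hsc.continuousOn, cfc_const_one ℝ T]
      have hk' : cfc s T k = 0 := hk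
      simp [hk']
    have h2 : ∀ n, ⟪v - w n, k⟫_ℂ = 0 := by
      intro n
      have := ContinuousLinearMap.adjoint_inner_left (cfc (f n) T) k v
      rw [(hself _).adjoint_eq, hfk] at this
      rw [inner_sub_left, this, sub_self]
    have h3 : Tendsto (fun n => ⟪v - w n, k⟫_ℂ) atTop (𝓝 ⟪v - w₀, k⟫_ℂ) :=
      (tendsto_const_nhds.sub hw₀).inner tendsto_const_nhds
    simp only [h2] at h3
    exact (tendsto_nhds_unique h3 tendsto_const_nhds)
  have hlast : Tendsto (fun n => ∫ t, f n t ∂ν) atTop (𝓝 (⟪v, specProj T c v⟫_ℂ).re) := by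
    simp only [fun n => hν _ (hfc n).continuousOn]
    rw [hproj]
    exact (Complex.continuous_re.tendsto _).comp (tendsto_const_nhds.inner hw₀)
  exact tendsto_nhds_unique hint hlast

/-- The measure on `ℝ` which represents `f ↦ ∑ i, ⟪e i, f(T) (e i)⟫`. -/
theorem exists_spectralMeasure {ι : Type*} [Fintype ι] (T : H →L[ℂ] H) (hT : IsSelfAdjoint T)
    (e : ι → H) :
    ∃ ν : Measure ℝ, IsFiniteMeasure ν ∧ ν (spectrum ℝ T)ᶜ = 0 ∧
      (∀ f : ℝ → ℝ, ContinuousOn f (spectrum ℝ T) →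
        IntegrableOn f (Set.Ioi 0) ν ∧ ∫ t, f t ∂ν = (∑ i, ⟪e i, cfc f T (e i)⟫_ℂ).re) ∧
      ∀ c, ν.real (Set.Iic c) = (∑ i, ⟪e i, specProj T c (e i)⟫_ℂ).re := by
  choose ν hfin hsupp hint using fun i => exists_vectorSpectralMeasure T hT (e i)
  refine ⟨∑ i, ν i, inferInstance, ?_, fun f hf => ?_, fun c => ?_⟩
  · rw [Measure.finsetSum_apply]
    exact Finset.sum_eq_zero fun i _ => hsupp i
  · have hb : ∀ i, Integrable f (ν i) := fun i => by
      have h1 : (ν i).restrict (spectrum ℝ T) = ν i :=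
        Measure.restrict_eq_self_of_ae_mem (by simpa [ae_iff] using! hsupp i)
      rw [← h1]
      exact hf.integrableOn_compact (spectrum.isCompact T)
    refine ⟨(integrable_finsetSum_measure.2 fun i _ => hb i).integrableOn, ?_⟩
    rw [integral_finsetSum_measure fun i _ => hb i, Complex.re_sum]
    exact Finset.sum_congr rfl fun i _ => hint i f hf
  · rw [measureReal_def, Measure.finsetSum_apply, Complex.re_sum,
      ENNReal.toReal_sum fun i _ => measure_ne_top _ _]
    exact Finset.sum_congr rfl fun i _ => measureReal_Iic_eq_specProj T hT _ (ν i) (hint i) c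

/-- The series `-log x = ∑ (1 - x)^(n+1) / (n+1)` computes the integral of the logarithm against
the spectral measure of `S* S` for invertible `S`. -/
theorem exists_spectralMeasure_log {ι : Type*} [Fintype ι] (S : H →L[ℂ] H) (hS : IsUnit S)
    (e : ι → H) :
    ∃ ν : Measure ℝ, IsFiniteMeasure ν ∧ IntegrableOn Real.log (Set.Ioi 0) ν ∧
      (∀ c, ν.real (Set.Iic c) =
        (∑ i, ⟪e i, specProj (ContinuousLinearMap.adjoint S ∘L S) c (e i)⟫_ℂ).re) ∧
      ∀ c : ℝ, 0 < c → ‖ContinuousLinearMap.adjoint S ∘L S‖ ≤ c →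
        ‖1 - (c : ℂ)⁻¹ • (ContinuousLinearMap.adjoint S ∘L S)‖ < 1 ∧
        HasSum (fun n : ℕ => (∑ i, ⟪e i, ((1 - (c : ℂ)⁻¹ •
            (ContinuousLinearMap.adjoint S ∘L S)) ^ (n + 1)) (e i)⟫_ℂ).re / (n + 1))
          (Real.log c * (∑ i, ⟪e i, e i⟫_ℂ).re - ∫ t in Set.Ioi 0, Real.log t ∂ν) := by
  set T := ContinuousLinearMap.adjoint S ∘L S with hTdef
  have hTS : T = star S * S := rfl
  have hT : IsSelfAdjoint T := hTS ▸ IsSelfAdjoint.star_mul_self S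
  have hpos : 0 ≤ T := hTS ▸ star_mul_self_nonneg S
  have hunit : IsUnit T := hTS ▸ hS.star.mul hS
  have hspec : ∀ t ∈ spectrum ℝ T, 0 < t := fun t ht =>
    lt_of_le_of_ne (spectrum_nonneg_of_nonneg hpos ht)
      (fun h => spectrum.zero_notMem ℝ hunit (h ▸ ht))
  have hlog : ContinuousOn Real.log (spectrum ℝ T) :=
    Real.continuousOn_log.mono fun t ht => (hspec t ht).ne'
  obtain ⟨ν, hfin, hsupp, hint, hcdf⟩ := exists_spectralMeasure T hT e
  have hae : ∀ᵐ t ∂ν, t ∈ spectrum ℝ T := by simpa [ae_iff] using! hsupp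
  -- Invertibility puts the spectrum inside `(0,∞)`, so excluding `0` from the integral loses no
  -- mass.
  have hres : ν.restrict (Set.Ioi 0) = ν :=
    Measure.restrict_eq_self_of_ae_mem (hae.mono hspec)
  have hI : ∀ f : ℝ → ℝ, ContinuousOn f (spectrum ℝ T) → Integrable f ν := fun f hf => by
    rw [← hres]
    exact (hint f hf).1
  refine ⟨ν, hfin, (hint _ hlog).1, hcdf, fun c hc hTc => ?_⟩
  have hcfc : ∀ n : ℕ, cfc (fun t : ℝ => (1 - c⁻¹ * t) ^ n) T = (1 - (c : ℂ)⁻¹ • T) ^ n := by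
    intro n
    have h1 : (c : ℂ)⁻¹ • T = c⁻¹ • T := by
      rw [← Complex.ofReal_inv]
      rfl
    rw [cfc_pow _ n T (by fun_prop), cfc_sub _ _ T (by fun_prop) (by fun_prop),
      cfc_const_one ℝ T, cfc_const_mul_id c⁻¹ T, h1]
  have hle : ∀ t ∈ spectrum ℝ T, t ≤ c := fun t ht => by
    have := norm_apply_le_norm_cfc (fun x : ℝ => x) T ht
    rw [cfc_id' ℝ T] at this
    exact (le_abs_self t).trans (this.trans hTc)
  have habs : ∀ t ∈ spectrum ℝ T, |1 - c⁻¹ * t| < 1 := fun t ht => by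
    have h1 : 0 < c⁻¹ * t := mul_pos (inv_pos.2 hc) (hspec t ht)
    have h2 : c⁻¹ * t ≤ 1 := by
      rw [inv_mul_le_iff₀ hc, mul_one]
      exact hle t ht
    rw [abs_lt]
    constructor <;> linarith
  have hnorm : ‖1 - (c : ℂ)⁻¹ • T‖ < 1 := by
    rw [← pow_one (1 - (c : ℂ)⁻¹ • T), ← hcfc]
    exact norm_cfc_lt one_pos fun t ht => by simpa using habs t ht
  refine ⟨hnorm, ?_⟩
  set r := ‖1 - (c : ℂ)⁻¹ • T‖
  have hr : ∀ t ∈ spectrum ℝ T, |1 - c⁻¹ * t| ≤ r := fun t ht => by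
    have := norm_apply_le_norm_cfc (fun x : ℝ => (1 - c⁻¹ * x) ^ 1) T ht
    rw [hcfc] at this
    simpa using this
  -- Terms of the series for `-log x` at `x = t / c`, with sum `log c - log t`. On the spectrum they
  -- are bounded by `r ^ n` with `r < 1`, so sum and integral commute.
  let F : ℕ → ℝ → ℝ := fun n t => (1 - c⁻¹ * t) ^ (n + 1) / (n + 1)
  have hFc : ∀ n, Continuous (F n) := fun n => by fun_prop
  have hFint : ∀ n, Integrable (F n) ν := fun n => hI _ (hFc n).continuousOn
  have hFr : ∀ n, ∀ᵐ t ∂ν, ‖F n t‖ ≤ r ^ n := fun n => by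
    filter_upwards [hae] with t ht
    have h0 : (1 : ℝ) ≤ n + 1 := by simp
    simp only [F]
    rw [norm_div, norm_pow, Real.norm_eq_abs, Real.norm_of_nonneg (by positivity), pow_succ]
    refine (div_le_self (by positivity) h0).trans ?_
    calc |1 - c⁻¹ * t| ^ n * |1 - c⁻¹ * t| ≤ r ^ n * 1 :=
          mul_le_mul (pow_le_pow_left₀ (abs_nonneg _) (hr t ht) n) (habs t ht).le
            (abs_nonneg _) (by positivity)
      _ = r ^ n := mul_one _
  have hsum : Summable fun n => ∫ t, ‖F n t‖ ∂ν := by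
    refine Summable.of_nonneg_of_le (fun n => integral_nonneg fun t => norm_nonneg _)
      (fun n => ?_) ((summable_geometric_of_lt_one (norm_nonneg _) hnorm).mul_right
        (ν.real Set.univ))
    calc ∫ t, ‖F n t‖ ∂ν ≤ ∫ _, r ^ n ∂ν :=
          integral_mono_ae (hFint n).norm (integrable_const _) (hFr n)
      _ = r ^ n * ν.real Set.univ := by rw [integral_const, smul_eq_mul, mul_comm]
  have hmain := hasSum_integral_of_summable_integral_norm hFint hsum
  have h1 : ∀ᵐ t ∂ν, ∑' n, F n t = Real.log c - Real.log t := by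
    filter_upwards [hae] with t ht
    have h2 := Real.hasSum_pow_div_log_of_abs_lt_one (habs t ht)
    rw [sub_sub_cancel, Real.log_mul (inv_ne_zero hc.ne') (hspec t ht).ne', Real.log_inv] at h2
    rw [h2.tsum_eq]
    ring
  have h2 : (∑ i, ⟪e i, e i⟫_ℂ).re = ν.real Set.univ := by
    have := (hint (fun _ => 1) continuousOn_const).2
    rw [cfc_const_one ℝ T] at this
    simpa using this.symm
  rw [integral_congr_ae h1, integral_sub (integrable_const _) (hI _ hlog), integral_const,
    smul_eq_mul, mul_comm] at hmain
  rw [hres, h2]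
  convert! hmain using 2 with n
  have h3 : F n = fun t => ((n : ℝ) + 1)⁻¹ * (1 - c⁻¹ * t) ^ (n + 1) := by
    funext t
    simp only [F]
    ring
  rw [h3, integral_const_mul, (hint (fun t => (1 - c⁻¹ * t) ^ (n + 1)) (by fun_prop)).2, hcfc]
  ring

end SpectralMeasure

/-! ### The Lebesgue-Stieltjes measure of the spectral density -/

section SpecMeasure

variable {π : Type*} [Group π] {d : ℕ}

/-- A finite measure whose distribution function is the spectral density function is the
Lebesgue-Stieltjes measure `dF_T`. -/
theorem specMeasure_eq_of_measureReal_Iic (T : L2Pow π d →L[ℂ] L2Pow π d) (ν : Measure ℝ)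
    [IsFiniteMeasure ν] (hcdf : ∀ c, ν.real (Set.Iic c) = specDensity T c) :
    specMeasure T = ν := by
  -- A distribution function of a finite measure is already right-continuous, so passing to right
  -- limits changes nothing.
  have hright : ∀ c, (specDensity_mono T).stieltjesFunction c = specDensity T c := by
    intro c
    rw [Monotone.stieltjesFunction_eq]
    refine rightLim_eq_of_tendsto ?_
    have h1 := tendsto_measure_biInter_gt (μ := ν) (s := fun x : ℝ => Set.Iic x) (a := c)
      (fun r _ => measurableSet_Iic.nullMeasurableSet) (fun i j _ hij => Set.Iic_subset_Iic.2 hij)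
      ⟨c + 1, by simp, measure_ne_top _ _⟩
    have h2 : ⋂ r > c, Set.Iic r = Set.Iic c := by
      ext t
      simp only [Set.mem_iInter, Set.mem_Iic]
      exact ⟨fun h => le_of_forall_gt_imp_ge_of_dense h, fun h r hr => h.trans hr.le⟩
    rw [h2] at h1
    rw [show specDensity T = fun x => ν.real (Set.Iic x) from funext fun x => (hcdf x).symm]
    exact (ENNReal.tendsto_toReal (measure_ne_top _ _)).comp h1
  refine (Measure.ext_of_Ioc _ _ fun a b hab => ?_).symm
  rw [specMeasure, StieltjesFunction.measure_Ioc, hright, hright, ← hcdf, ← hcdf,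
    ← measureReal_sdiff (Set.Iic_subset_Iic.2 hab.le) measurableSet_Iic, Set.Iic_sdiff_Iic,
    ofReal_measureReal]

/-- For invertible `S` the logarithm of the determinant of `S* S` is finite and given by the
trace of the logarithm series. -/
theorem exists_lnDet_eq_hasSum (S : L2Pow π d →L[ℂ] L2Pow π d) (hS : IsUnit S) :
    ∃ r : ℝ, lnDet (ContinuousLinearMap.adjoint S ∘L S) = (r : EReal) ∧
      ∀ c : ℝ, 0 < c → ‖ContinuousLinearMap.adjoint S ∘L S‖ ≤ c →
        ‖1 - (c : ℂ)⁻¹ • (ContinuousLinearMap.adjoint S ∘L S)‖ < 1 ∧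
        HasSum (fun n : ℕ => (trace ((1 - (c : ℂ)⁻¹ •
            (ContinuousLinearMap.adjoint S ∘L S)) ^ (n + 1))).re / (n + 1))
          (Real.log c * (trace (1 : L2Pow π d →L[ℂ] L2Pow π d)).re - r) := by
  obtain ⟨ν, hfin, hlog, hcdf, hsum⟩ :=
    exists_spectralMeasure_log S hS (fun i : Fin d => unitVec π i)
  have hν := specMeasure_eq_of_measureReal_Iic (ContinuousLinearMap.adjoint S ∘L S) ν hcdf
  refine ⟨∫ t in Set.Ioi 0, Real.log t ∂ν, ?_, hsum⟩
  rw [lnDet, hν, if_pos hlog]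

end SpecMeasure

/-! ### The trace of the logarithm along affine paths -/

section LogSeries

variable {A : Type*} [NormedRing A] [NormedAlgebra ℂ A]

/-- The value of the functional `τ` at `-log (1 - u)`. -/
def logSeries (τ : A →L[ℂ] ℂ) (u : A) : ℂ := ∑' n : ℕ, τ (u ^ (n + 1)) / (n + 1)

theorem summable_logSeries (τ : A →L[ℂ] ℂ) {u : A} (hu : ‖u‖ < 1) :
    Summable fun n : ℕ => τ (u ^ (n + 1)) / ((n : ℂ) + 1) := by
  refine Summable.of_norm_bounded
    (((summable_nat_add_iff 1).2 (summable_geometric_of_lt_one (norm_nonneg u) hu)).mul_left ‖τ‖)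
    fun n => ?_
  have h0 : (1 : ℝ) ≤ ‖(n : ℂ) + 1‖ := by
    rw [← Nat.cast_succ, Complex.norm_natCast]
    exact_mod_cast n.succ_pos
  rw [norm_div]
  exact (div_le_self (norm_nonneg _) h0).trans
    ((τ.le_opNorm _).trans (mul_le_mul_of_nonneg_left (norm_pow_le' _ n.succ_pos)
      (norm_nonneg _)))

theorem re_logSeries_eq {τ : A →L[ℂ] ℂ} {u : A} (hu : ‖u‖ < 1) {x : ℝ}
    (h : HasSum (fun n : ℕ => (τ (u ^ (n + 1))).re / (n + 1)) x) : (logSeries τ u).re = x := by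
  have h1 := Complex.hasSum_re (summable_logSeries τ hu).hasSum
  refine h1.unique (h.congr_fun fun n => ?_)
  have : ((n : ℂ) + 1) = ((n + 1 : ℝ) : ℂ) := by push_cast; rfl
  rw [this, Complex.div_ofReal_re]

/-- Needed because `τ` is tracial only on the centralizer, while the derivative of the logarithm
involves inverses. `Ring.inverse` of a non-unit is `0`, so no invertibility hypothesis is required.
-/
theorem inverse_mem_centralizer {M : Set A} {x : A} (hx : x ∈ Subalgebra.centralizer ℂ M) :
    Ring.inverse x ∈ Subalgebra.centralizer ℂ M := by
  by_cases h : IsUnit x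
  · obtain ⟨x, rfl⟩ := h
    rw [Ring.inverse_unit, Subalgebra.mem_centralizer_iff]
    intro m hm
    have h1 : Commute m (x : A) := (Subalgebra.mem_centralizer_iff ℂ).1 hx m hm
    exact h1.units_inv_right
  · rw [Ring.inverse_non_unit _ h]
    exact zero_mem _

variable [CompleteSpace A]

/-- Term by term, `τ(u^(n+1)) / (n+1)` has derivative `τ(u^n b)`, and these sum to the geometric
series of `(1 - u)⁻¹`. The uniform bound `r < 1` justifies differentiating the sum. -/
theorem hasDerivAt_logSeries (τ : A →L[ℂ] ℂ) (M : Set A)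
    (hτ : ∀ x ∈ Subalgebra.centralizer ℂ M, ∀ y ∈ Subalgebra.centralizer ℂ M,
      τ (x * y) = τ (y * x))
    {a b : A} (ha : a ∈ Subalgebra.centralizer ℂ M) (hb : b ∈ Subalgebra.centralizer ℂ M)
    {r : ℝ} (hr : r < 1) {U : Set ℂ} (hU : IsOpen U) (hUc : IsPreconnected U)
    (hur : ∀ z ∈ U, ‖a + z • b‖ ≤ r) {z : ℂ} (hz : z ∈ U) :
    HasDerivAt (fun z : ℂ => logSeries τ (a + z • b))
      (τ (Ring.inverse (1 - (a + z • b)) * b)) z := by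
  have hr0 : 0 ≤ r := (norm_nonneg _).trans (hur z hz)
  have hmem : ∀ z : ℂ, a + z • b ∈ Subalgebra.centralizer ℂ M := fun z =>
    add_mem ha (Subalgebra.smul_mem _ hb z)
  have hterm : ∀ (n : ℕ) (y : ℂ), y ∈ U →
      HasDerivAt (fun z : ℂ => τ ((a + z • b) ^ (n + 1)) / ((n : ℂ) + 1))
        (τ ((a + y • b) ^ n * b)) y := by
    intro n y _
    have h1 : HasDerivAt (fun z : ℂ => a + z • b) b y := by
      simpa using ((hasDerivAt_id y).smul_const b).const_add a
    have h2 := (τ.hasFDerivAt.comp_hasDerivAt y (h1.fun_pow' (n + 1))).div_const ((n : ℂ) + 1)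
    -- Although `u` and `b` need not commute, cyclicity of `τ` makes all `n + 1` summands of the
    -- product rule equal.
    have h3 : τ (∑ i ∈ Finset.range (n + 1),
        (a + y • b) ^ ((n + 1).pred - i) * b * (a + y • b) ^ i) / ((n : ℂ) + 1)
        = τ ((a + y • b) ^ n * b) := by
      have h4 : ∀ i ∈ Finset.range (n + 1),
          τ ((a + y • b) ^ ((n + 1).pred - i) * b * (a + y • b) ^ i)
            = τ ((a + y • b) ^ n * b) := by
        intro i hi
        rw [hτ _ (mul_mem (pow_mem (hmem y) _) hb) _ (pow_mem (hmem y) _), ← mul_assoc,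
          ← pow_add, Nat.pred_succ, Nat.add_sub_cancel' (Finset.mem_range_succ_iff.1 hi)]
      rw [map_sum, Finset.sum_congr rfl h4, Finset.sum_const, Finset.card_range, nsmul_eq_mul]
      have : ((n : ℂ) + 1) ≠ 0 := Nat.cast_add_one_ne_zero n
      push_cast
      field_simp
    rw [h3] at h2
    exact h2
  -- The factor `‖1‖` covers `n = 0`, as `‖1‖ = 1` is not assumed in `A`.
  have hbound : ∀ (n : ℕ) (y : ℂ), y ∈ U → ‖τ ((a + y • b) ^ n * b)‖ ≤
      ‖τ‖ * (‖(1 : A)‖ * r ^ n * ‖b‖) := by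
    intro n y hy
    refine (τ.le_opNorm _).trans (mul_le_mul_of_nonneg_left ?_ (norm_nonneg _))
    refine (norm_mul_le _ _).trans (mul_le_mul_of_nonneg_right ?_ (norm_nonneg _))
    rcases n.eq_zero_or_pos with rfl | hn
    · simp
    · rcases subsingleton_or_nontrivial A with hA | hA
      · rw [Subsingleton.elim ((a + y • b) ^ n) 0, norm_zero]
        positivity
      · have : 1 ≤ ‖(1 : A)‖ := one_le_norm_one A
        calc ‖(a + y • b) ^ n‖ ≤ ‖a + y • b‖ ^ n := norm_pow_le' _ hn
          _ ≤ r ^ n := pow_le_pow_left₀ (norm_nonneg _) (hur y hy) n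
          _ ≤ ‖(1 : A)‖ * r ^ n := le_mul_of_one_le_left (by positivity) this
  have hsumm : Summable fun n : ℕ => ‖τ‖ * (‖(1 : A)‖ * r ^ n * ‖b‖) :=
    (((summable_geometric_of_lt_one hr0 hr).mul_left _).mul_right _).mul_left _
  have h := hasDerivAt_tsum_of_isPreconnected hsumm hU hUc hterm hbound hz
    (summable_logSeries τ ((hur z hz).trans_lt hr)) hz
  have h5 := τ.hasSum ((hasSum_geom_series_inverse (a + z • b) ((hur z hz).trans_lt hr)).mul_right b)
  rw [← h5.tsum_eq]
  exact h

/-- Multiplicativity of the Fuglede-Kadison determinant, in terms of the logarithm series. -/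
theorem logSeries_conj_sub (τ : A →L[ℂ] ℂ) (M : Set A)
    (hτ : ∀ x ∈ Subalgebra.centralizer ℂ M, ∀ y ∈ Subalgebra.centralizer ℂ M,
      τ (x * y) = τ (y * x))
    {S B C : A} (hBu : IsUnit B) (hCu : IsUnit C)
    (hS : S ∈ Subalgebra.centralizer ℂ M)
    (hB : B ∈ Subalgebra.centralizer ℂ M) (hC : C ∈ Subalgebra.centralizer ℂ M)
    {k l : ℂ} (hk : k ≠ 0) (hl : l ≠ 0)
    (hu₀ : ‖1 - k • (1 : A)‖ < 1) (hu₁ : ‖1 - k • S‖ < 1)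
    (hw₀ : ‖1 - l • (C * B)‖ < 1) (hw₁ : ‖1 - l • (C * S * B)‖ < 1) :
    logSeries τ (1 - k • S) - logSeries τ (1 - k • (1 : A)) =
      logSeries τ (1 - l • (C * S * B)) - logSeries τ (1 - l • (C * B)) := by
  obtain ⟨B, rfl⟩ := hBu
  obtain ⟨C, rfl⟩ := hCu
  obtain ⟨r, hr, hr1⟩ := exists_between (max_lt (max_lt hu₀ hu₁) (max_lt hw₀ hw₁))
  rw [max_lt_iff, max_lt_iff, max_lt_iff] at hr
  obtain ⟨⟨hu₀, hu₁⟩, hw₀, hw₁⟩ := hr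
  set N := Subalgebra.centralizer ℂ M
  -- With `X_z = 1 - z(1 - S)`, these are chosen so that `1 - (a + z b) = k X_z` and `1 - (a' + z
  -- b') = l C X_z B`. The endpoints `z = 0, 1` are the four arguments in the statement; `U` is a
  -- convex open set containing both, on which both series converge.
  let a := 1 - k • (1 : A)
  let b := k • (1 - S)
  let a' := 1 - l • (C * B : A)
  let b' := l • (C * (1 - S) * B : A)
  have ha : a ∈ N := sub_mem (one_mem _) (N.smul_mem (one_mem _) _)
  have hb : b ∈ N := N.smul_mem (sub_mem (one_mem _) hS) _
  have ha' : a' ∈ N := sub_mem (one_mem _) (N.smul_mem (mul_mem hC hB) _)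
  have hb' : b' ∈ N := N.smul_mem (mul_mem (mul_mem hC (sub_mem (one_mem _) hS)) hB) _
  have e1 : 1 - k • S = a + (1 : ℂ) • b := by
    simp only [a, b, one_smul, smul_sub]
    abel
  have e1' : 1 - l • (C * S * B : A) = a' + (1 : ℂ) • b' := by
    simp only [a', b', one_smul, mul_sub, sub_mul, smul_sub, mul_one]
    abel
  have e0 : a = a + (0 : ℂ) • b := by simp
  have e0' : a' = a' + (0 : ℂ) • b' := by simp
  let U : Set ℂ := (fun z : ℂ => a + z • b) ⁻¹' Metric.ball 0 r ∩
    (fun z : ℂ => a' + z • b') ⁻¹' Metric.ball 0 r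
  have hconv : ∀ p q : A, Convex ℝ ((fun z : ℂ => p + z • q) ⁻¹' Metric.ball 0 r) := by
    intro p q x hx y hy s t hs ht hst
    have h1 := convex_ball (0 : A) r hx hy hs ht hst
    have h2 : p + (s • x + t • y) • q = s • (p + x • q) + t • (p + y • q) := by
      rw [add_smul, smul_assoc, smul_assoc, smul_add, smul_add]
      nth_rewrite 1 [← one_smul ℝ p]
      rw [← hst, add_smul]
      abel
    simp only [Set.mem_preimage, h2]
    exact h1
  have hUo : IsOpen U := by
    refine (Metric.isOpen_ball.preimage ?_).inter (Metric.isOpen_ball.preimage ?_) <;> fun_prop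
  have hUc : IsPreconnected U := ((hconv a b).inter (hconv a' b')).isPreconnected
  have h0 : (0 : ℂ) ∈ U := by
    refine ⟨?_, ?_⟩
    · simpa only [Set.mem_preimage, mem_ball_zero_iff, ← e0] using hu₀
    · simpa only [Set.mem_preimage, mem_ball_zero_iff, ← e0'] using hw₀
  have h1 : (1 : ℂ) ∈ U := by
    refine ⟨?_, ?_⟩
    · simpa only [Set.mem_preimage, mem_ball_zero_iff, ← e1] using hu₁
    · simpa only [Set.mem_preimage, mem_ball_zero_iff, ← e1'] using hw₁
  have hd : ∀ z ∈ U, HasDerivAt (fun z : ℂ => logSeries τ (a' + z • b') - logSeries τ (a + z • b))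
      0 z := by
    intro z hz
    have hzu : ∀ y ∈ U, ‖a + y • b‖ ≤ r := fun y hy => (mem_ball_zero_iff.1 hy.1).le
    have hzw : ∀ y ∈ U, ‖a' + y • b'‖ ≤ r := fun y hy => (mem_ball_zero_iff.1 hy.2).le
    convert! (hasDerivAt_logSeries τ M hτ ha' hb' hr1 hUo hUc hzw hz).sub
      (hasDerivAt_logSeries τ M hτ ha hb hr1 hUo hUc hzu hz) using 1
    obtain ⟨x, hx⟩ := isUnit_one_sub_of_norm_lt_one ((hzu z hz).trans_lt hr1)
    have hxinv : ((x⁻¹ : Aˣ) : A) ∈ N := by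
      rw [← Ring.inverse_unit, hx]
      exact inverse_mem_centralizer (sub_mem (one_mem _) (add_mem ha (N.smul_mem hb _)))
    have hBinv : ((B⁻¹ : Aˣ) : A) ∈ N := by
      rw [← Ring.inverse_unit]
      exact inverse_mem_centralizer hB
    -- With `x = k X_z`, the ratio `l / k` rewrites `l C X_z B` as `m C x B`.
    let m : ℂˣ := Units.mk0 (l / k) (div_ne_zero hl hk)
    have hy : 1 - (a' + z • b') = ((m • (C * x * B) : Aˣ) : A) := by
      rw [Units.val_smul, Units.val_mul, Units.val_mul, hx]
      have e2 : 1 - (a + z • b) = k • (1 - z • (1 - S)) := by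
        simp only [a, b, smul_sub, smul_comm z k]
        abel
      have e3 : 1 - (a' + z • b') = l • (C * (1 - z • (1 - S)) * B : A) := by
        simp only [a', b', mul_sub, sub_mul, smul_sub, mul_one, mul_smul_comm, smul_mul_assoc,
          smul_comm z l]
        abel
      rw [e2, e3, Units.smul_def, Units.val_mk0, mul_smul_comm, smul_mul_assoc, smul_smul,
        div_mul_cancel₀ _ hk]
    rw [hy, ← hx, Ring.inverse_unit, Ring.inverse_unit]
    -- `m` and `C` cancel, leaving the conjugate of `x⁻¹ b` by `B`, whose trace is the derivative of
    -- the other series.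
    have h2 : (((m • (C * x * B))⁻¹ : Aˣ) : A) * b' = ((B⁻¹ : Aˣ) : A) * (x⁻¹ * b * B) := by
      have e4 : b' = m • (C * b * B : A) := by
        simp only [b, b', m]
        rw [Units.smul_def, Units.val_mk0, mul_smul_comm, smul_mul_assoc, smul_smul,
          div_mul_cancel₀ _ hk]
      rw [Units.inv_mul_eq_iff_eq_mul, e4]
      simp [Units.smul_def, mul_assoc]
    have h3 : τ (((B⁻¹ : Aˣ) : A) * (x⁻¹ * b * B)) = τ (x⁻¹ * b) := by
      rw [hτ _ hBinv _ (mul_mem (mul_mem hxinv hb) hB), mul_assoc, mul_assoc, Units.mul_inv,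
        mul_one]
    rw [h2, h3, sub_self]
  have hconst := hUo.is_const_of_deriv_eq_zero hUc
    (fun z hz => (hd z hz).differentiableAt.differentiableWithinAt)
    (fun z hz => (hd z hz).deriv) h0 h1
  simp only [← e0, ← e0', ← e1, ← e1'] at hconst
  change logSeries τ (1 - k • S) - logSeries τ a = logSeries τ (1 - l • (C * S * B : A)) -
    logSeries τ a'
  linear_combination hconst

end LogSeries

section Adjoint

theorem adjoint_one_comp_one (H : Type*) [NormedAddCommGroup H] [InnerProductSpace ℂ H]
    [CompleteSpace H] :
    ContinuousLinearMap.adjoint (1 : H →L[ℂ] H) ∘L (1 : H →L[ℂ] H) = 1 := by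
  change star (1 : H →L[ℂ] H) * 1 = 1
  rw [star_one, one_mul]

theorem adjoint_mul_comp_mul {H : Type*} [NormedAddCommGroup H] [InnerProductSpace ℂ H]
    [CompleteSpace H] (S T : H →L[ℂ] H) :
    ContinuousLinearMap.adjoint (S * T) ∘L (S * T) =
      ContinuousLinearMap.adjoint T * (ContinuousLinearMap.adjoint S ∘L S) * T := by
  change star (S * T) * (S * T) = star T * (star S * S) * T
  rw [star_mul]
  simp only [mul_assoc]

end Adjoint

/-! ### The trace property and multiplicativity of the determinant -/

section Tracial

variable {π : Type*} [Group π] {d : ℕ}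

theorem memlp_translateRight (g : π) (f : L2 π) :
    Memℓp (fun h : π => (f : π → ℂ) (h * g)) 2 := by
  have hf := lp.memℓp f
  rw [memℓp_gen_iff (by norm_num)] at hf ⊢
  exact hf.comp_injective (mul_left_injective g)

/-- Right translation by `g` on `ℓ²(π)`: `(R_g f)(h) = f (h g)`. -/
def translateRight (g : π) : L2 π →L[ℂ] L2 π :=
  LinearMap.mkContinuous
    { toFun := fun f => ⟨fun h : π => (f : π → ℂ) (h * g), memlp_translateRight g f⟩
      map_add' := fun _ _ => rfl
      map_smul' := fun _ _ => rfl } 1 (by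
    intro f
    rw [one_mul]
    refine lp.norm_le_of_forall_sum_le (by norm_num) (norm_nonneg _) fun s => ?_
    have h1 := lp.sum_rpow_le_norm_rpow (p := 2) (by norm_num) f
      (s.map ⟨fun h => h * g, mul_left_injective g⟩)
    rw [Finset.sum_map] at h1
    exact h1)

theorem translateRight_apply (g : π) (f : L2 π) (h : π) :
    (translateRight g f : π → ℂ) h = (f : π → ℂ) (h * g) := rfl

/-- Right translation by `g` in each coordinate of `ℓ²(π)^d`. -/
def translateRightPow (d : ℕ) (g : π) : L2Pow π d →L[ℂ] L2Pow π d :=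
  (PiLp.continuousLinearEquiv 2 ℂ (fun _ : Fin d => L2 π)).symm.toContinuousLinearMap ∘L
    ContinuousLinearMap.pi fun i => translateRight g ∘L PiLp.proj 2 (fun _ : Fin d => L2 π) i

theorem translateRightPow_apply (g : π) (x : L2Pow π d) (i : Fin d) :
    translateRightPow d g x i = translateRight g (x i) := by
  simp [translateRightPow]

theorem inner_translateRightPow (g : π) (x y : L2Pow π d) :
    ⟪x, translateRightPow d g⁻¹ y⟫_ℂ = ⟪translateRightPow d g x, y⟫_ℂ := by
  rw [PiLp.inner_apply, PiLp.inner_apply]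
  refine Finset.sum_congr rfl fun i _ => ?_
  rw [lp.inner_eq_tsum, lp.inner_eq_tsum, ← (Equiv.mulRight g).tsum_eq]
  simp [translateRightPow_apply, translateRight_apply]

theorem inner_unitVec (i : Fin d) (x : L2Pow π d) : ⟪unitVec π i, x⟫_ℂ = (x i : π → ℂ) 1 := by
  classical
  rw [PiLp.inner_apply, Finset.sum_eq_single i]
  · simp [unitVec, lp.inner_single_left]
  · intro j _ hj
    simp [unitVec, hj]
  · simp

/-- The operators on `ℓ²(π)^d` which commute with the right translations: the matrix algebra over
the group von Neumann algebra. -/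
abbrev rightCommutant (π : Type*) [Group π] (d : ℕ) : Subalgebra ℂ (L2Pow π d →L[ℂ] L2Pow π d) :=
  Subalgebra.centralizer ℂ (Set.range (translateRightPow d))

theorem translateRightPow_comm {T : L2Pow π d →L[ℂ] L2Pow π d} (hT : T ∈ rightCommutant π d)
    (g : π) (x : L2Pow π d) : translateRightPow d g (T x) = T (translateRightPow d g x) :=
  congrArg (fun U : L2Pow π d →L[ℂ] L2Pow π d => U x)
    ((Subalgebra.mem_centralizer_iff ℂ).1 hT _ ⟨g, rfl⟩)

/-- Commuting with right translations makes every matrix coefficient of `S` a translate of a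
coefficient at a unit vector, so the product becomes a convolution evaluated at `1`. Swapping `h`
and `h⁻¹` then exchanges `S` and `T`. -/
theorem inner_unitVec_mul (S T : L2Pow π d →L[ℂ] L2Pow π d) (hS : S ∈ rightCommutant π d)
    (i : Fin d) :
    ⟪unitVec π i, (S * T) (unitVec π i)⟫_ℂ = ∑ j, ∑' h : π,
      (S (unitVec π j) i : π → ℂ) h⁻¹ * (T (unitVec π i) j : π → ℂ) h := by
  rw [mul_apply_eq_comp, ← ContinuousLinearMap.adjoint_inner_left, PiLp.inner_apply]
  refine Finset.sum_congr rfl fun j _ => ?_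
  rw [lp.inner_eq_tsum]
  refine tsum_congr fun h => ?_
  have h1 : ∀ x : L2Pow π d, (x j : π → ℂ) h = ⟪translateRightPow d h⁻¹ (unitVec π j), x⟫_ℂ := by
    intro x
    have := inner_translateRightPow h⁻¹ (unitVec π j) x
    rw [inv_inv] at this
    rw [← this, inner_unitVec, translateRightPow_apply, translateRight_apply, one_mul]
  have h2 : (starRingEnd ℂ) ((ContinuousLinearMap.adjoint S (unitVec π i) j : π → ℂ) h) =
      (S (unitVec π j) i : π → ℂ) h⁻¹ := by
    rw [h1, inner_conj_symm, ContinuousLinearMap.adjoint_inner_left,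
      ← translateRightPow_comm hS, inner_unitVec, translateRightPow_apply, translateRight_apply,
      one_mul]
  rw [RCLike.inner_apply, h2, mul_comm]

/-- The trace property of `tr_π`. -/
theorem trace_mul_comm (S T : L2Pow π d →L[ℂ] L2Pow π d) (hS : S ∈ rightCommutant π d)
    (hT : T ∈ rightCommutant π d) : trace (S * T) = trace (T * S) := by
  simp only [trace, inner_unitVec_mul S T hS, inner_unitVec_mul T S hT]
  rw [Finset.sum_comm]
  refine Finset.sum_congr rfl fun i _ => Finset.sum_congr rfl fun j _ => ?_
  rw [← (Equiv.inv π).tsum_eq]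
  exact tsum_congr fun h => by simp [mul_comm]

/-- `tr_π` as a continuous linear functional. -/
def traceCLM (π : Type*) [Group π] (d : ℕ) : (L2Pow π d →L[ℂ] L2Pow π d) →L[ℂ] ℂ :=
  ∑ i : Fin d, innerSL ℂ (unitVec π i) ∘L
    ContinuousLinearMap.apply ℂ (L2Pow π d) (unitVec π i)

theorem traceCLM_apply (T : L2Pow π d →L[ℂ] L2Pow π d) : traceCLM π d T = trace T := by
  simp [traceCLM, trace]

theorem adjoint_mem_rightCommutant {T : L2Pow π d →L[ℂ] L2Pow π d}
    (hT : T ∈ rightCommutant π d) : ContinuousLinearMap.adjoint T ∈ rightCommutant π d := by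
  rw [Subalgebra.mem_centralizer_iff]
  rintro _ ⟨g, rfl⟩
  ext1 x
  refine ext_inner_left ℂ fun y => ?_
  rw [mul_apply_eq_comp, mul_apply_eq_comp, ContinuousLinearMap.adjoint_inner_right]
  have h1 : ∀ a b : L2Pow π d,
      ⟪a, translateRightPow d g b⟫_ℂ = ⟪translateRightPow d g⁻¹ a, b⟫_ℂ := fun a b => by
    simpa using inner_translateRightPow g⁻¹ a b
  rw [h1, h1, translateRightPow_comm hT, ContinuousLinearMap.adjoint_inner_right]

/-- The real number `ln Det_π(S* S)` for invertible `S`. -/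
def realLnDet (S : L2Pow π d →L[ℂ] L2Pow π d) : ℝ :=
  (lnDet (ContinuousLinearMap.adjoint S ∘L S)).toReal

/-- For invertible `S` the value `-∞` does not occur, so `EReal.toReal` loses nothing. -/
theorem lnDet_eq_realLnDet (S : L2Pow π d →L[ℂ] L2Pow π d) (hS : IsUnit S) :
    lnDet (ContinuousLinearMap.adjoint S ∘L S) = (realLnDet S : EReal) := by
  obtain ⟨r, hr, -⟩ := exists_lnDet_eq_hasSum S hS
  rw [realLnDet, hr, EReal.toReal_coe]

theorem hasSum_realLnDet (S : L2Pow π d →L[ℂ] L2Pow π d) (hS : IsUnit S) {c : ℝ} (hc : 0 < c)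
    (h : ‖ContinuousLinearMap.adjoint S ∘L S‖ ≤ c) :
    ‖1 - (c : ℂ)⁻¹ • (ContinuousLinearMap.adjoint S ∘L S)‖ < 1 ∧
      HasSum (fun n : ℕ => (trace ((1 - (c : ℂ)⁻¹ •
          (ContinuousLinearMap.adjoint S ∘L S)) ^ (n + 1))).re / (n + 1))
        (Real.log c * (trace (1 : L2Pow π d →L[ℂ] L2Pow π d)).re - realLnDet S) := by
  obtain ⟨r, hr, hsum⟩ := exists_lnDet_eq_hasSum S hS
  rw [realLnDet, hr, EReal.toReal_coe]
  exact hsum c hc h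

theorem re_logSeries_traceCLM (S : L2Pow π d →L[ℂ] L2Pow π d) (hS : IsUnit S) {c : ℝ}
    (hc : 0 < c) (h : ‖ContinuousLinearMap.adjoint S ∘L S‖ ≤ c) :
    (logSeries (traceCLM π d) (1 - (c : ℂ)⁻¹ • (ContinuousLinearMap.adjoint S ∘L S))).re =
      Real.log c * (trace (1 : L2Pow π d →L[ℂ] L2Pow π d)).re - realLnDet S := by
  obtain ⟨h1, h2⟩ := hasSum_realLnDet S hS hc h
  exact re_logSeries_eq h1 (by simpa only [traceCLM_apply] using h2)

theorem realLnDet_one : realLnDet (1 : L2Pow π d →L[ℂ] L2Pow π d) = 0 := by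
  have e1 : ContinuousLinearMap.adjoint (1 : L2Pow π d →L[ℂ] L2Pow π d) ∘L
      (1 : L2Pow π d →L[ℂ] L2Pow π d) = 1 := adjoint_one_comp_one _
  -- At scale `c = 1` the argument `1 - c⁻¹ • 1` is zero, so every term of the series vanishes.
  have h := (hasSum_realLnDet (1 : L2Pow π d →L[ℂ] L2Pow π d) isUnit_one one_pos (by
    rw [e1]
    exact ContinuousLinearMap.norm_id_le)).2
  have e2 : 1 - ((1 : ℝ) : ℂ)⁻¹ • (1 : L2Pow π d →L[ℂ] L2Pow π d) = 0 := by
    rw [Complex.ofReal_one, inv_one, one_smul, sub_self]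
  have h0 : (trace (0 : L2Pow π d →L[ℂ] L2Pow π d)).re = 0 := by
    rw [← traceCLM_apply, map_zero, Complex.zero_re]
  rw [e1, e2, Real.log_one, zero_mul, zero_sub] at h
  have h1 : ∀ n : ℕ, (trace ((0 : L2Pow π d →L[ℂ] L2Pow π d) ^ (n + 1))).re / ((n : ℝ) + 1) = 0 :=
    fun n => by rw [zero_pow n.succ_ne_zero, h0, zero_div]
  exact neg_eq_zero.1 (h.unique (hasSum_zero.congr_fun h1))

/-- The Fuglede-Kadison determinant is multiplicative. -/
theorem realLnDet_mul {S T : L2Pow π d →L[ℂ] L2Pow π d} (hS : IsUnit S) (hT : IsUnit T)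
    (hSN : S ∈ rightCommutant π d) (hTN : T ∈ rightCommutant π d) :
    realLnDet (S * T) = realLnDet S + realLnDet T := by
  let I : L2Pow π d →L[ℂ] L2Pow π d := 1
  -- One scale serves both ends of each path, so the terms `log k · tr 1` and `log l · tr 1` cancel
  -- in the differences.
  let k : ℝ := max 1 (max ‖ContinuousLinearMap.adjoint S ∘L S‖ ‖ContinuousLinearMap.adjoint I ∘L I‖)
  let l : ℝ := max 1 (max ‖ContinuousLinearMap.adjoint (S * T) ∘L (S * T)‖
    ‖ContinuousLinearMap.adjoint T ∘L T‖)
  have hk : 0 < k := lt_max_of_lt_left one_pos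
  have hl : 0 < l := lt_max_of_lt_left one_pos
  have k1 : ‖ContinuousLinearMap.adjoint S ∘L S‖ ≤ k := le_max_of_le_right (le_max_left _ _)
  have k2 : ‖ContinuousLinearMap.adjoint I ∘L I‖ ≤ k := le_max_of_le_right (le_max_right _ _)
  have l1 : ‖ContinuousLinearMap.adjoint (S * T) ∘L (S * T)‖ ≤ l :=
    le_max_of_le_right (le_max_left _ _)
  have l2 : ‖ContinuousLinearMap.adjoint T ∘L T‖ ≤ l := le_max_of_le_right (le_max_right _ _)
  have e1 : ContinuousLinearMap.adjoint (S * T) ∘L (S * T) =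
      ContinuousLinearMap.adjoint T * (ContinuousLinearMap.adjoint S ∘L S) * T :=
    adjoint_mul_comp_mul _ _
  have e2 : ContinuousLinearMap.adjoint T ∘L T = ContinuousLinearMap.adjoint T * T := rfl
  have e3 : ContinuousLinearMap.adjoint I ∘L I = 1 := adjoint_one_comp_one _
  have hu₁ := (hasSum_realLnDet S hS hk k1).1
  have hu₀ := (hasSum_realLnDet I isUnit_one hk k2).1
  have hw₁ := (hasSum_realLnDet (S * T) (hS.mul hT) hl l1).1
  have hw₀ := (hasSum_realLnDet T hT hl l2).1
  have v₁ := re_logSeries_traceCLM S hS hk k1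
  have v₀ := re_logSeries_traceCLM I isUnit_one hk k2
  have w₁ := re_logSeries_traceCLM (S * T) (hS.mul hT) hl l1
  have w₀ := re_logSeries_traceCLM T hT hl l2
  have hI : realLnDet I = 0 := realLnDet_one
  rw [e3] at hu₀ v₀
  rw [e1] at hw₁ w₁
  rw [e2] at hw₀ w₀
  have h := logSeries_conj_sub (S := ContinuousLinearMap.adjoint S ∘L S) (B := T)
    (C := ContinuousLinearMap.adjoint T) (traceCLM π d) (Set.range (translateRightPow d))
    (fun x hx y hy => by
      rw [traceCLM_apply, traceCLM_apply]
      exact trace_mul_comm x y hx hy) hT hT.star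
    (mul_mem (adjoint_mem_rightCommutant hSN) hSN) hTN (adjoint_mem_rightCommutant hTN)
    (inv_ne_zero (Complex.ofReal_ne_zero.2 hk.ne'))
    (inv_ne_zero (Complex.ofReal_ne_zero.2 hl.ne')) hu₀ hu₁ hw₀ hw₁
  have h' := congrArg Complex.re h
  rw [Complex.sub_re, Complex.sub_re] at h'
  rw [v₁, v₀, w₁, w₀, hI] at h'
  linarith

end Tracial

/-! ### Matrices over the group ring as operators, and their adjoints -/

section MatrixOperators

variable {π : Type*} [Group π] {d : ℕ}

theorem matOp_one : matOp (1 : Matrix (Fin d) (Fin d) (MonoidAlgebra ℤ π)) = 1 := by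
  ext1 x
  refine PiLp.ext fun i => ?_
  rw [matOp_apply, Finset.sum_eq_single i]
  · simp
  · intro j _ hj
    simp [Matrix.one_apply_ne' hj]
  · simp

theorem matOp_mul (A B : Matrix (Fin d) (Fin d) (MonoidAlgebra ℤ π)) :
    matOp (A * B) = matOp A * matOp B := by
  ext1 x
  refine PiLp.ext fun i => ?_
  rw [mul_apply_eq_comp, matOp_apply, matOp_apply]
  simp only [matOp_apply, Matrix.mul_apply, map_sum, map_mul, sum_apply, mul_apply_eq_comp]
  rw [Finset.sum_comm]

theorem isUnit_matOp (A : GL (Fin d) (MonoidAlgebra ℤ π)) : IsUnit (matOp A.val) := by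
  refine ⟨⟨matOp A.val, matOp A.inv, ?_, ?_⟩, rfl⟩
  · rw [← matOp_mul, A.val_inv, matOp_one]
  · rw [← matOp_mul, A.inv_val, matOp_one]

theorem ringAct_single (g : π) (n : ℤ) :
    ringAct (MonoidAlgebra.single g n) = n • translate g :=
  MonoidAlgebra.lift_single _ _ _

theorem translateRight_ringAct (g : π) (a : MonoidAlgebra ℤ π) (f : L2 π) :
    translateRight g (ringAct a f) = ringAct a (translateRight g f) := by
  induction a using MonoidAlgebra.induction_linear with
  | zero => simp
  | add a b ha hb => simp [ha, hb]
  | single h n =>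
    rw [ringAct_single, smul_apply, smul_apply, map_zsmul]
    congr 1
    ext x
    simp [translateRight_apply, mul_assoc]

/-- Left multiplication commutes with right translation; this makes the trace property available for
group-ring matrices. -/
theorem matOp_mem_rightCommutant (A : Matrix (Fin d) (Fin d) (MonoidAlgebra ℤ π)) :
    matOp A ∈ rightCommutant π d := by
  rw [Subalgebra.mem_centralizer_iff]
  rintro _ ⟨g, rfl⟩
  ext1 x
  refine PiLp.ext fun i => ?_
  simp only [mul_apply_eq_comp, translateRightPow_apply, matOp_apply, map_sum,
    translateRight_ringAct]

/-- The conjugate transpose of a matrix over `ℤπ`, for the involution `g ↦ g⁻¹` of `ℤπ`. -/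
def starMat (A : Matrix (Fin d) (Fin d) (MonoidAlgebra ℤ π)) :
    Matrix (Fin d) (Fin d) (MonoidAlgebra ℤ π) :=
  Matrix.of fun i j => MonoidAlgebra.mapDomain (fun g : π => g⁻¹) (A j i)

theorem inner_translate (g : π) (x y : L2 π) : ⟪translate g x, y⟫_ℂ = ⟪x, translate g⁻¹ y⟫_ℂ := by
  rw [lp.inner_eq_tsum, lp.inner_eq_tsum, ← (Equiv.mulLeft g).tsum_eq]
  simp

theorem inner_ringAct (a : MonoidAlgebra ℤ π) (x y : L2 π) :
    ⟪ringAct (MonoidAlgebra.mapDomain (fun g : π => g⁻¹) a) x, y⟫_ℂ = ⟪x, ringAct a y⟫_ℂ := by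
  induction a using MonoidAlgebra.induction_linear with
  | zero => simp
  | add a b ha hb =>
    rw [MonoidAlgebra.mapDomain_add, map_add, map_add, add_apply, add_apply, inner_add_left,
      inner_add_right, ha, hb]
  | single h n =>
    rw [MonoidAlgebra.mapDomain_single, ringAct_single, ringAct_single, smul_apply, smul_apply,
      ← Int.cast_smul_eq_zsmul ℂ, ← Int.cast_smul_eq_zsmul ℂ, inner_smul_left, inner_smul_right,
      inner_translate, inv_inv, map_intCast]

theorem adjoint_matOp (A : Matrix (Fin d) (Fin d) (MonoidAlgebra ℤ π)) :
    ContinuousLinearMap.adjoint (matOp A) = matOp (starMat A) := by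
  symm
  rw [ContinuousLinearMap.eq_adjoint_iff]
  intro x y
  simp only [PiLp.inner_apply, matOp_apply, sum_inner, inner_sum, starMat, Matrix.of_apply,
    inner_ringAct]
  exact Finset.sum_comm

/-- Keeps `A* A` inside matrices over `ℤπ`, as needed for stabilization and for applying
semi-integrality. -/
theorem adjoint_matOp_comp (A : Matrix (Fin d) (Fin d) (MonoidAlgebra ℤ π)) :
    ContinuousLinearMap.adjoint (matOp A) ∘L matOp A = matOp (starMat A * A) := by
  rw [adjoint_matOp, matOp_mul]
  rfl

theorem starMat_stabMat {n m : ℕ} (h : n ≤ m)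
    (A : Matrix (Fin n) (Fin n) (MonoidAlgebra ℤ π)) :
    starMat (stabMat (MonoidAlgebra ℤ π) h A) = stabMat (MonoidAlgebra ℤ π) h (starMat A) := by
  refine Matrix.ext fun i j => ?_
  simp only [starMat, stabMat, MonoidHom.coe_mk, OneHom.coe_mk, Matrix.of_apply]
  by_cases hij : i.1 < n ∧ j.1 < n
  · rw [dif_pos hij, dif_pos hij.symm]
  · rw [dif_neg hij, dif_neg fun h => hij h.symm]
    by_cases e : i = j
    · subst e
      simp [MonoidAlgebra.one_def]
    · rw [if_neg e, if_neg fun h => e h.symm, MonoidAlgebra.mapDomain_zero]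

end MatrixOperators

/-! ### Block decomposition and invariance under stabilization -/

section ExtendZero

variable {π : Type*} {n k : ℕ}

/-- Extension by zero `ℓ²(π)^n → ℓ²(π)^(n+k)`. -/
def extendZero (π : Type*) (n k : ℕ) : L2Pow π n →L[ℂ] L2Pow π (n + k) :=
  (PiLp.continuousLinearEquiv 2 ℂ (fun _ : Fin (n + k) => L2 π)).symm.toContinuousLinearMap ∘L
    ContinuousLinearMap.pi
      (Fin.append (fun i => PiLp.proj 2 (fun _ : Fin n => L2 π) i) fun _ => 0)

theorem extendZero_castAdd (x : L2Pow π n) (i : Fin n) :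
    extendZero π n k x (Fin.castAdd k i) = x i := by
  simp [extendZero]

theorem extendZero_natAdd (x : L2Pow π n) (i : Fin k) :
    extendZero π n k x (Fin.natAdd n i) = 0 := by
  simp [extendZero]

theorem inner_extendZero (x y : L2Pow π n) :
    ⟪extendZero π n k x, extendZero π n k y⟫_ℂ = ⟪x, y⟫_ℂ := by
  rw [PiLp.inner_apply, PiLp.inner_apply, Fin.sum_univ_add]
  simp [extendZero_castAdd, extendZero_natAdd]

end ExtendZero

section Stabilization

variable {π : Type*} [Group π] {n k : ℕ}

/-- `unitVec π (0 : Fin 1) 0` is a name for `δ_1` independent of `n`, which lets unit vectors of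
different sizes be compared. -/
theorem unitVec_apply (i j : Fin n) :
    unitVec π i j = if j = i then unitVec π (0 : Fin 1) 0 else 0 := by
  by_cases h : j = i
  · subst h
    simp [unitVec]
  · simp [unitVec, h]

theorem extendZero_unitVec (i : Fin n) :
    extendZero π n k (unitVec π i) = unitVec π (Fin.castAdd k i) := by
  refine PiLp.ext fun j => ?_
  induction j using Fin.addCases with
  | left j =>
    rw [extendZero_castAdd, unitVec_apply i j, unitVec_apply (Fin.castAdd k i) (Fin.castAdd k j)]
    simp
  | right j =>
    rw [extendZero_natAdd, unitVec_apply, if_neg]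
    simp [Fin.ext_iff]
    omega

theorem matOp_stabMat_extendZero (D : Matrix (Fin n) (Fin n) (MonoidAlgebra ℤ π))
    (x : L2Pow π n) :
    matOp (stabMat (MonoidAlgebra ℤ π) (Nat.le_add_right n k) D) (extendZero π n k x) =
      extendZero π n k (matOp D x) := by
  refine PiLp.ext fun j => ?_
  rw [matOp_apply, Fin.sum_univ_add]
  induction j using Fin.addCases with
  | left j => simp [extendZero_castAdd, extendZero_natAdd, stabMat]
  | right j =>
    have h : ∀ i : Fin n, Fin.natAdd n j ≠ Fin.castAdd k i := fun i h => by
      have := congrArg Fin.val h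
      simp at this
      omega
    simp [extendZero_castAdd, extendZero_natAdd, stabMat, h]

theorem matOp_stabMat_unitVec (D : Matrix (Fin n) (Fin n) (MonoidAlgebra ℤ π)) (i : Fin k) :
    matOp (stabMat (MonoidAlgebra ℤ π) (Nat.le_add_right n k) D) (unitVec π (Fin.natAdd n i)) =
      unitVec π (Fin.natAdd n i) := by
  refine PiLp.ext fun j => ?_
  rw [matOp_apply, Finset.sum_eq_single (Fin.natAdd n i)]
  · by_cases h : j = Fin.natAdd n i
    · subst h
      simp [stabMat]
    · rw [unitVec_apply _ j, if_neg h]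
      simp [stabMat, h]
  · intro l _ hl
    rw [unitVec_apply, if_neg hl, map_zero]
  · simp

theorem inner_unitVec_self (i : Fin n) : ⟪unitVec π i, unitVec π i⟫_ℂ = 1 := by
  rw [inner_unitVec]
  simp [unitVec]

theorem trace_one : trace (1 : L2Pow π n →L[ℂ] L2Pow π n) = n := by
  simp only [trace, one_apply_eq_self, inner_unitVec_self]
  simp

/-- The operator of `D ⊕ 1` preserves the first `n` coordinates, where it is that of `D`, and fixes
each of the `k` new unit vectors, where `1 - c • T` is the scalar `1 - c`. -/
theorem trace_pow_stabMat (D : Matrix (Fin n) (Fin n) (MonoidAlgebra ℤ π)) (c : ℂ) (N : ℕ) :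
    trace ((1 - c • matOp (stabMat (MonoidAlgebra ℤ π) (Nat.le_add_right n k) D)) ^ N) =
      trace ((1 - c • matOp D) ^ N) + k * (1 - c) ^ N := by
  set T := matOp (stabMat (MonoidAlgebra ℤ π) (Nat.le_add_right n k) D) with hT
  have h1 : ∀ (N : ℕ) (x : L2Pow π n), ((1 - c • T) ^ N) (extendZero π n k x) =
      extendZero π n k (((1 - c • matOp D) ^ N) x) := by
    intro N
    induction N with
    | zero => simp
    | succ N ih =>
      intro x
      rw [pow_succ, pow_succ, mul_apply_eq_comp, mul_apply_eq_comp, ← ih]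
      congr 1
      simp only [sub_apply, smul_apply, one_apply_eq_self, map_sub, map_smul, hT,
        matOp_stabMat_extendZero]
  have h2 : ∀ (N : ℕ) (i : Fin k), ((1 - c • T) ^ N) (unitVec π (Fin.natAdd n i)) =
      (1 - c) ^ N • unitVec π (Fin.natAdd n i) := by
    intro N i
    induction N with
    | zero => simp
    | succ N ih =>
      have h3 : (1 - c • T) (unitVec π (Fin.natAdd n i)) =
          (1 - c) • unitVec π (Fin.natAdd n i) := by
        simp only [sub_apply, smul_apply, one_apply_eq_self, hT,
          matOp_stabMat_unitVec, sub_smul, one_smul]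
      rw [pow_succ, mul_apply_eq_comp, h3, map_smul, ih, smul_smul, pow_succ, mul_comm]
  rw [trace, Fin.sum_univ_add]
  simp only [← extendZero_unitVec, h1, inner_extendZero, h2, inner_smul_right,
    inner_unitVec_self, mul_one, Finset.sum_const, Finset.card_univ, Fintype.card_fin,
    nsmul_eq_mul]
  rfl

/-- The Fuglede-Kadison determinant is invariant under stabilization. -/
theorem realLnDet_stab {n m : ℕ} (h : n ≤ m) (A : GL (Fin n) (MonoidAlgebra ℤ π)) :
    realLnDet (matOp (stab (MonoidAlgebra ℤ π) n m h A).val) = realLnDet (matOp A.val) := by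
  obtain ⟨k, rfl⟩ := Nat.exists_eq_add_of_le h
  set A' := stab (MonoidAlgebra ℤ π) n (n + k) h A with hA'
  have hval : A'.val = stabMat (MonoidAlgebra ℤ π) (Nat.le_add_right n k) A.val := rfl
  have e : ContinuousLinearMap.adjoint (matOp A'.val) ∘L matOp A'.val =
      matOp (stabMat (MonoidAlgebra ℤ π) (Nat.le_add_right n k) (starMat A.val * A.val)) := by
    rw [adjoint_matOp_comp, hval, starMat_stabMat, map_mul]
  let T := ContinuousLinearMap.adjoint (matOp A.val) ∘L matOp A.val
  let T' := ContinuousLinearMap.adjoint (matOp A'.val) ∘L matOp A'.val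
  let c : ℝ := max 1 (max ‖T‖ ‖T'‖)
  have hc1 : 1 ≤ c := le_max_left _ _
  have hc : 0 < c := one_pos.trans_le hc1
  have h1 := (hasSum_realLnDet (matOp A.val) (isUnit_matOp A) hc
    (le_max_of_le_right (le_max_left _ _))).2
  have h2 := (hasSum_realLnDet (matOp A'.val) (isUnit_matOp A') hc
    (le_max_of_le_right (le_max_right _ _))).2
  have habs : |1 - c⁻¹| < 1 := by
    have : c⁻¹ ≤ 1 := inv_le_one_of_one_le₀ hc1
    rw [abs_of_nonneg (by linarith)]
    linarith [inv_pos.2 hc]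
  -- The `k` new blocks contribute `k log c`, exactly the change of `log c · tr 1` from `n` to `n +
  -- k`.
  have h3 := (Real.hasSum_pow_div_log_of_abs_lt_one habs).mul_left (k : ℝ)
  rw [e] at h2
  rw [adjoint_matOp_comp] at h1
  have h4 := h2.unique ((h1.add h3).congr_fun fun N => by
    rw [trace_pow_stabMat, Complex.add_re, add_div, mul_div_assoc']
    congr 2
    have : (k : ℂ) * (1 - (c : ℂ)⁻¹) ^ (N + 1) = ((k * (1 - c⁻¹) ^ (N + 1) : ℝ) : ℂ) := by
      push_cast
      rfl
    rw [this, Complex.ofReal_re])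
  rw [sub_sub_cancel, Real.log_inv, trace_one, trace_one, Complex.natCast_re,
    Complex.natCast_re, Nat.cast_add] at h4
  linarith

end Stabilization

/-! ### Descent to the Whitehead group and the conclusions -/

section WhiteheadGroup

variable {π : Type*} [Group π]

/-- The homomorphism `A ↦ ln Det_π(A* A)` on `GL_d(ℤπ)`. -/
def lnDetGL (π : Type*) [Group π] (d : ℕ) :
    GL (Fin d) (MonoidAlgebra ℤ π) →* Multiplicative ℝ where
  toFun A := Multiplicative.ofAdd (realLnDet (matOp A.val))
  map_one' := by
    rw [Units.val_one, matOp_one, realLnDet_one]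
    rfl
  map_mul' A B := by
    rw [Units.val_mul, matOp_mul, realLnDet_mul (isUnit_matOp A) (isUnit_matOp B)
      (matOp_mem_rightCommutant _) (matOp_mem_rightCommutant _)]
    rfl

theorem lnDetStar_eq {d : ℕ} (A : GL (Fin d) (MonoidAlgebra ℤ π)) :
    lnDetStar A.val = (((lnDetGL π d A).toAdd : ℝ) : EReal) :=
  lnDet_eq_realLnDet _ (isUnit_matOp A)

/-- The homomorphism `A ↦ ln Det_π(A* A)` on the stable general linear group. -/
def lnDetStable (π : Type*) [Group π] : StableGL (MonoidAlgebra ℤ π) →* Multiplicative ℝ where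
  toFun := DirectLimit.lift (stab (MonoidAlgebra ℤ π)) (fun d A => lnDetGL π d A)
    fun _ _ h A => congrArg Multiplicative.ofAdd (realLnDet_stab h A).symm
  map_one' := DirectLimit.lift_one (lnDetGL π) _
  map_mul' := DirectLimit.lift_mul (lnDetGL π) _

/-- The homomorphism `A ↦ ln Det_π(A* A)` on `K₁(ℤπ)`. -/
def lnDetK1 (π : Type*) [Group π] : K1 (MonoidAlgebra ℤ π) →* Multiplicative ℝ :=
  Abelianization.lift (lnDetStable π)

/-- The determinant sees `A` only through `A* A`, here the identity. -/
theorem lnDetGL_eq_one_of_starMat_mul {d : ℕ} (A : GL (Fin d) (MonoidAlgebra ℤ π))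
    (h : starMat A.val * A.val = 1) : lnDetGL π d A = 1 := by
  have h1 : ContinuousLinearMap.adjoint (matOp A.val) ∘L matOp A.val =
      ContinuousLinearMap.adjoint (1 : L2Pow π d →L[ℂ] L2Pow π d) ∘L
        (1 : L2Pow π d →L[ℂ] L2Pow π d) := by
    rw [adjoint_matOp_comp, h, matOp_one, adjoint_one_comp_one]
  have h2 : realLnDet (matOp A.val) = 0 := by
    rw [realLnDet, h1]
    exact realLnDet_one
  exact congrArg Multiplicative.ofAdd h2

theorem starMat_groupUnit_mul (g : π) :
    starMat (groupUnit π g).val * (groupUnit π g).val = 1 := by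
  refine Matrix.ext fun i j => ?_
  have hi := Subsingleton.elim i 0
  have hj := Subsingleton.elim j 0
  subst hi hj
  simp [Matrix.mul_apply, starMat, groupUnit, MonoidAlgebra.single_mul_single,
    MonoidAlgebra.one_def]

theorem trivialUnits_le_ker : trivialUnits π ≤ (lnDetK1 π).ker := by
  refine (Subgroup.closure_le _).2 ?_
  rintro _ ⟨g, rfl | rfl⟩
  · exact lnDetGL_eq_one_of_starMat_mul _ (starMat_groupUnit_mul g)
  · refine lnDetGL_eq_one_of_starMat_mul _ ?_
    rw [← starMat_groupUnit_mul g, Units.val_neg]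
    refine Matrix.ext fun i j => ?_
    have hneg : ∀ a : MonoidAlgebra ℤ π, MonoidAlgebra.mapDomain (fun g : π => g⁻¹) (-a) =
        -MonoidAlgebra.mapDomain (fun g : π => g⁻¹) a := fun a => by
      rw [eq_neg_iff_add_eq_zero, ← MonoidAlgebra.mapDomain_add, neg_add_cancel,
        MonoidAlgebra.mapDomain_zero]
    simp [Matrix.mul_apply, starMat, hneg]

/-- The homomorphism `A ↦ ln Det_π(A* A)` on `Wh(π)`. -/
def lnDetWhHom (π : Type*) [Group π] : Wh π →* Multiplicative ℝ :=
  QuotientGroup.lift (trivialUnits π) (lnDetK1 π) trivialUnits_le_ker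

theorem lnDetWhHom_mk {d : ℕ} (A : GL (Fin d) (MonoidAlgebra ℤ π)) :
    (((lnDetWhHom π (Wh.mk A)).toAdd : ℝ) : EReal) = lnDetStar A.val :=
  (lnDetStar_eq A).symm

/-- The arbitrary representative chosen in `lnDetWh` is harmless, as the homomorphism takes the same
value on every representative. -/
theorem lnDetWh_eq (w : Wh π) : lnDetWh w = (((lnDetWhHom π w).toAdd : ℝ) : EReal) := by
  conv_rhs => rw [← (Wh.mk_surjective w).choose_spec.choose_spec]
  rw [lnDetWhHom_mk]
  rfl

/-- The values at `w` and `w⁻¹` are negatives of each other and both are nonnegative. -/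
theorem lnDetWh_eq_zero_of_nonneg (h : ∀ w : Wh π, 0 ≤ lnDetWh w) (w : Wh π) :
    lnDetWh w = 0 := by
  have h1 := h w
  have h2 := h w⁻¹
  rw [lnDetWh_eq, EReal.coe_nonneg] at h1 h2
  rw [map_inv, toAdd_inv] at h2
  rw [lnDetWh_eq, EReal.coe_eq_zero]
  linarith

theorem whiteheadTrivialDet_of_semiIntegralDet (h : SemiIntegralDet π) :
    WhiteheadTrivialDet π := by
  refine lnDetWh_eq_zero_of_nonneg fun w => ?_
  obtain ⟨d, A, rfl⟩ := Wh.mk_surjective w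
  rw [lnDetWh_eq, lnDetWhHom_mk, lnDetStar, adjoint_matOp_comp]
  refine h d _ ?_
  rw [← adjoint_matOp_comp]
  exact ContinuousLinearMap.isPositive_adjoint_comp_self _

end WhiteheadGroup

end GroupDet

end

theorem mainTheorem5 (π : Type*) [Group π] :
    (∀ (d : ℕ) (A : GL (Fin d) (MonoidAlgebra ℤ π)),
      GroupDet.lnDetWh (GroupDet.Wh.mk A) = GroupDet.lnDetStar A.val) ∧
    ((∀ w : GroupDet.Wh π, 0 ≤ GroupDet.lnDetWh w) →
      ∀ w : GroupDet.Wh π, GroupDet.lnDetWh w = 0) ∧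
    (GroupDet.SemiIntegralDet π → GroupDet.WhiteheadTrivialDet π) :=
  ⟨fun _ A => (GroupDet.lnDetWh_eq _).trans (GroupDet.lnDetWhHom_mk A),
    GroupDet.lnDetWh_eq_zero_of_nonneg, GroupDet.whiteheadTrivialDet_of_semiIntegralDet⟩
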